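/- Let $X$ be a compact complex manifold of dimension $n$ and let $L$ be a big holomorphic line bundle on $X$, i.e. $\dim H^0(X,L^{\otimes k})\ge c\,k^n$ for some $c>0$ and all large $k$. Let $h^L$ be a continuous Hermitian metric on $L$. Put $n_k:=\dim H^0(X,L^{\otimes k})$ for $k\ge 0$ and $n_k:=0$ for $k<0$. Let $k_0\in\mathbb N$, let $s_1,s_2\in H^0(X,L^{\otimes k_0})$ be linearly independent, and let $\mu_0$ be a finite Borel measure on $X$ whose support is disjoint from $\operatorname{div}(s_2)=\{s_2=0\}$ and is not contained in any proper analytic subset of $X$. Then there is a constant $C>0$ such that for every integer $k\ge 1$ the following holds. The space $H^0(X,L^{\otimes k})$ is finite-dimensional and has an orthonormal basis for the form $\langle s,t\rangle=\int_X\langle s(x),t(x)\rangle_{(h^L)^k}\,d\mu_0(x)$. For every such basis $(e_i)_{i=1}^{n_k}$, the Christoffel–Darboux kernel $$B_{k,0}(x,y):=\sum_{i=1}^{n_k} e_i(x)\cdot e_i(y)^*\in L_x^{\otimes k}\otimes (L_y^{\otimes k})^*$$ satisfies (the integral being convergent) $$\iint \big|B_{k,0}(x,y)\big|^2_{(h^L)^k}\cdot\Big|\frac{s_1(x)}{s_2(x)}-\frac{s_1(y)}{s_2(y)}\Big|^2\,d\mu_0(x)\,d\mu_0(y)\;\le\;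 C\,(n_k-n_{k-k_0}).$$ -/

import Mathlib

open Bundle MeasureTheory
open scoped Manifold ContDiff TensorProduct ComplexConjugate

noncomputable section HolomorphicLineBundles

/-! ### Tensor powers of a complex line -/

/-- The linear functional `v₁ ⊗ ⋯ ⊗ v_k ↦ ℓ v₁ ⋯ ℓ v_k` on `V^{⊗k}` induced by a linear
functional `ℓ` on `V`. -/
def tensorPowerFunctional {V : Type*} [AddCommGroup V] [Module ℂ V] (ℓ : V →ₗ[ℂ] ℂ) (k : ℕ) :
    (⨂[ℂ]^k V) →ₗ[ℂ] ℂ :=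
  PiTensorProduct.lift
    ((MultilinearMap.mkPiAlgebra ℂ (Fin k) ℂ).compLinearMap (fun _ => ℓ))

theorem tensorPowerFunctional_tprod {V : Type*} [AddCommGroup V] [Module ℂ V]
    (ℓ : V →ₗ[ℂ] ℂ) (k : ℕ) (v : Fin k → V) :
    tensorPowerFunctional ℓ k (PiTensorProduct.tprod ℂ v) = ∏ i, ℓ (v i) := by
  simp [tensorPowerFunctional]

/-- If every `v` equals `ℓ v • e` then every `t ∈ V^{⊗k}` equals its coordinate times `e^{⊗k}`. -/
theorem tensorPowerFunctional_smul {V : Type*} [AddCommGroup V] [Module ℂ V]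
    (ℓ : V →ₗ[ℂ] ℂ) (e : V) (he : ∀ v, ℓ v • e = v) (k : ℕ) (t : ⨂[ℂ]^k V) :
    tensorPowerFunctional ℓ k t • PiTensorProduct.tprod ℂ (fun _ : Fin k => e) = t := by
  induction t using PiTensorProduct.induction_on with
  | smul_tprod r v =>
    rw [map_smul, tensorPowerFunctional_tprod, smul_eq_mul, mul_smul,
      ← MultilinearMap.map_smul_univ]
    simp [he]
  | add a b ha hb => rw [map_add, add_smul, ha, hb]

variable {X : Type*} [TopologicalSpace X]
variable (L : X → Type*) [∀ x, AddCommGroup (L x)] [∀ x, Module ℂ (L x)]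
  [TopologicalSpace (TotalSpace ℂ L)] [∀ x, TopologicalSpace (L x)]
  [FiberBundle ℂ L] [VectorBundle ℂ ℂ L]

/-- The coordinate at `x` of an element of `L_x^{⊗k}` with respect to the `k`-th tensor power of the
local frame of `L` given by the preferred trivialization around `x₀`
(meaningful for `x` in the domain of that trivialization). -/
def lineCoord (k : ℕ) (x₀ x : X) : (⨂[ℂ]^k (L x)) →ₗ[ℂ] ℂ :=
  tensorPowerFunctional ((trivializationAt ℂ L x₀).linearMapAt ℂ x) k

/-- The value at `x` of the local frame of `L` given by the preferred trivialization around `x`: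
a nonzero vector of the complex line `L_x`. -/
def frameVec (x : X) : L x := (trivializationAt ℂ L x).symmₗ ℂ x 1

/-- The `k`-th tensor power of `frameVec L x`, a nonzero vector of the complex line `L_x^{⊗k}`. -/
def framePow (k : ℕ) (x : X) : ⨂[ℂ]^k (L x) :=
  PiTensorProduct.tprod ℂ (fun _ : Fin k => frameVec L x)

theorem linearMapAt_frameVec (x : X) :
    (trivializationAt ℂ L x).linearMapAt ℂ x (frameVec L x) = 1 := by
  have hx := FiberBundle.mem_baseSet_trivializationAt' (F := ℂ) (E := L) x
  exact (trivializationAt ℂ L x).linearMapAt_symmₗ (R := ℂ) hx 1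

theorem linearMapAt_smul_frameVec (x : X) (v : L x) :
    (trivializationAt ℂ L x).linearMapAt ℂ x v • frameVec L x = v := by
  have hx := FiberBundle.mem_baseSet_trivializationAt' (F := ℂ) (E := L) x
  have h1 := (trivializationAt ℂ L x).symmₗ_linearMapAt (R := ℂ) hx v
  have h2 : frameVec L x = (trivializationAt ℂ L x).symmₗ ℂ x 1 := rfl
  rw [h2, ← map_smul, smul_eq_mul, mul_one, h1]

theorem frameVec_ne_zero (x : X) : frameVec L x ≠ 0 := by
  intro h
  have := linearMapAt_frameVec L x
  rw [h, map_zero] at this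
  exact zero_ne_one this

theorem lineCoord_framePow (k : ℕ) (x : X) : lineCoord L k x x (framePow L k x) = 1 := by
  simp [lineCoord, framePow, tensorPowerFunctional_tprod, linearMapAt_frameVec]

theorem lineCoord_smul_framePow (k : ℕ) (x : X) (t : ⨂[ℂ]^k (L x)) :
    lineCoord L k x x t • framePow L k x = t :=
  tensorPowerFunctional_smul _ _ (linearMapAt_smul_frameVec L x) k t

/-! ### Hermitian metrics -/

/-- A continuous Hermitian metric on `L`: a positive definite Hermitian form on each fibre
(conjugate-linear in the first variable) whose square norm is continuous on the total space. -/
structure HermitianMetric where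
  form : ∀ x, L x →ₗ⋆[ℂ] L x →ₗ[ℂ] ℂ
  conj_symm : ∀ x (v w : L x), conj (form x v w) = form x w v
  pos : ∀ x (v : L x), v ≠ 0 → 0 < (form x v v).re
  continuous_form : Continuous fun p : TotalSpace ℂ L => form p.proj p.snd p.snd

variable {L}

/-- The Hermitian form induced on `L_x^{⊗k}` by the metric: it is the form with
`⟨v₁ ⊗ ⋯ ⊗ v_k, w₁ ⊗ ⋯ ⊗ w_k⟩ = ∏ ⟨v_i, w_i⟩`, see `HermitianMetric.powForm_tprod`. -/
def HermitianMetric.powForm (h : HermitianMetric L) (k : ℕ) (x : X) :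
    (⨂[ℂ]^k (L x)) →ₗ⋆[ℂ] (⨂[ℂ]^k (L x)) →ₗ[ℂ] ℂ :=
  LinearMap.mk₂'ₛₗ (starRingEnd ℂ) (RingHom.id ℂ)
    (fun s t => conj (lineCoord L k x x s) * lineCoord L k x x t *
      (h.form x (frameVec L x) (frameVec L x)) ^ k)
    (by intros; simp only [map_add]; ring)
    (by intros; simp only [map_smul, smul_eq_mul, map_mul]; ring)
    (by intros; simp only [map_add]; ring)
    (by intros; simp only [map_smul, smul_eq_mul, RingHom.id_apply]; ring)

theorem HermitianMetric.powForm_apply (h : HermitianMetric L) (k : ℕ) (x : X)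
    (s t : ⨂[ℂ]^k (L x)) :
    h.powForm k x s t = conj (lineCoord L k x x s) * lineCoord L k x x t *
      (h.form x (frameVec L x) (frameVec L x)) ^ k := rfl

theorem HermitianMetric.powForm_tprod (h : HermitianMetric L) (k : ℕ) (x : X)
    (v w : Fin k → L x) :
    h.powForm k x (PiTensorProduct.tprod ℂ v) (PiTensorProduct.tprod ℂ w)
      = ∏ i, h.form x (v i) (w i) := by
  have key : ∀ a b : L x, h.form x a b =
      conj ((trivializationAt ℂ L x).linearMapAt ℂ x a) *
        (trivializationAt ℂ L x).linearMapAt ℂ x b *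
        h.form x (frameVec L x) (frameVec L x) := by
    intro a b
    conv_lhs => rw [← linearMapAt_smul_frameVec L x a, ← linearMapAt_smul_frameVec L x b]
    rw [LinearMap.map_smul, LinearMap.map_smulₛₗ, LinearMap.smul_apply, smul_eq_mul, smul_eq_mul]
    ring
  rw [powForm_apply, lineCoord, tensorPowerFunctional_tprod, tensorPowerFunctional_tprod, map_prod]
  simp_rw [fun i => key (v i) (w i)]
  rw [Finset.prod_mul_distrib, Finset.prod_mul_distrib, Finset.prod_const, Finset.card_univ,
    Fintype.card_fin]

/-- The norm induced on `L_x^{⊗k}` by the metric. -/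
def HermitianMetric.powNorm (h : HermitianMetric L) (k : ℕ) (x : X) (t : ⨂[ℂ]^k (L x)) : ℝ :=
  Real.sqrt (h.powForm k x t t).re

/-- The norm induced by the metric on `L_x^{⊗k} ⊗ (L_y^{⊗k})^* = Hom(L_y^{⊗k}, L_x^{⊗k})`. As both
spaces are complex lines, it is the ratio `|T v| / |v|` for any nonzero `v`;
see `HermitianMetric.powNorm_map`. -/
def HermitianMetric.homNorm (h : HermitianMetric L) (k : ℕ) (x y : X)
    (T : (⨂[ℂ]^k (L y)) →ₗ[ℂ] (⨂[ℂ]^k (L x))) : ℝ :=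
  h.powNorm k x (T (framePow L k y)) / h.powNorm k y (framePow L k y)

theorem HermitianMetric.powNorm_smul (h : HermitianMetric L) (k : ℕ) (x : X) (c : ℂ)
    (t : ⨂[ℂ]^k (L x)) : h.powNorm k x (c • t) = ‖c‖ * h.powNorm k x t := by
  have : h.powForm k x (c • t) (c • t) = ((‖c‖ ^ 2 : ℝ) : ℂ) * h.powForm k x t t := by
    rw [LinearMap.map_smul, LinearMap.map_smulₛₗ, LinearMap.smul_apply, smul_eq_mul, smul_eq_mul,
      ← mul_assoc, Complex.mul_conj']
    push_cast
    rfl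
  rw [powNorm, this, Complex.re_ofReal_mul, Real.sqrt_mul (by positivity),
    Real.sqrt_sq (norm_nonneg c), powNorm]

theorem HermitianMetric.powNorm_framePow_pos (h : HermitianMetric L) (k : ℕ) (x : X) :
    0 < h.powNorm k x (framePow L k x) := by
  have hp := h.pos x _ (frameVec_ne_zero L x)
  have him : h.form x (frameVec L x) (frameVec L x) =
      (((h.form x (frameVec L x) (frameVec L x)).re : ℝ) : ℂ) :=
    (Complex.conj_eq_iff_re.mp (h.conj_symm x _ _)).symm
  rw [powNorm, Real.sqrt_pos, powForm_apply, lineCoord_framePow, map_one, one_mul, one_mul, him,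
    ← Complex.ofReal_pow, Complex.ofReal_re]
  positivity

theorem HermitianMetric.powNorm_map (h : HermitianMetric L) (k : ℕ) (x y : X)
    (T : (⨂[ℂ]^k (L y)) →ₗ[ℂ] (⨂[ℂ]^k (L x))) (v : ⨂[ℂ]^k (L y)) :
    h.powNorm k x (T v) = h.homNorm k x y T * h.powNorm k y v := by
  have hp := h.powNorm_framePow_pos k y
  rw [← lineCoord_smul_framePow L k y v, map_smul, powNorm_smul, powNorm_smul, homNorm]
  field_simp

/-! ### Holomorphic sections -/

variable (E : Type*) [NormedAddCommGroup E] [NormedSpace ℂ E] [ChartedSpace E X]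

variable (L) in
/-- `H⁰(X, L^{⊗k})`: the sections of `L^{⊗k}` whose coordinates with respect to the (tensor powers
of the) local holomorphic frames of `L` are holomorphic functions. -/
def H0 (k : ℕ) : Submodule ℂ (∀ x, ⨂[ℂ]^k (L x)) where
  carrier := {s | ∀ x₀, MDifferentiableOn 𝓘(ℂ, E) 𝓘(ℂ, ℂ) (fun x => lineCoord L k x₀ x (s x))
    (trivializationAt ℂ L x₀).baseSet}
  add_mem' := by
    intro s t hs ht x₀
    simp only [Pi.add_apply, map_add]
    exact (hs x₀).add (ht x₀)
  zero_mem' := by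
    intro x₀
    simpa only [Pi.zero_apply, map_zero] using mdifferentiableOn_const
  smul_mem' := by
    intro c s hs x₀
    simp only [Pi.smul_apply, map_smul]
    exact (hs x₀).const_smul c

variable (L) in
/-- `n_k = dim H⁰(X, L^{⊗k})`. -/
def h0 (k : ℕ) : ℕ := Module.finrank ℂ (H0 L E k)

variable (L) in
/-- `L` is big: `dim H⁰(X, L^{⊗k}) ≥ c k^n` for some `c > 0` and all large `k`,
with `n = dim X`. -/
def IsBig : Prop :=
  ∃ c : ℝ, 0 < c ∧ ∀ᶠ k : ℕ in Filter.atTop, c * (k : ℝ) ^ Module.finrank ℂ E ≤ (h0 L E k : ℝ)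

variable {E}

/-- The zero set `div(s)` of a section. -/
def zeroLocus {k : ℕ} (s : H0 L E k) : Set X := {x | s.1 x = 0}

/-- The function `s₁ / s₂`, defined where `s₂ ≠ 0` (and `0` elsewhere); see `sectionRatio_smul`. -/
def sectionRatio {k : ℕ} (s₁ s₂ : H0 L E k) (x : X) : ℂ :=
  lineCoord L k x x (s₁.1 x) / lineCoord L k x x (s₂.1 x)

theorem sectionRatio_smul {k : ℕ} (s₁ s₂ : H0 L E k) (x : X) (hx : x ∉ zeroLocus s₂) :
    sectionRatio s₁ s₂ x • s₂.1 x = s₁.1 x := by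
  have h2 : lineCoord L k x x (s₂.1 x) ≠ 0 := by
    intro h
    apply hx
    have := lineCoord_smul_framePow L k x (s₂.1 x)
    rw [h, zero_smul] at this
    exact this.symm
  conv_lhs => rw [← lineCoord_smul_framePow L k x (s₂.1 x)]
  rw [smul_smul, sectionRatio, div_mul_cancel₀ _ h2, lineCoord_smul_framePow]

variable (E) in
/-- `A` is an analytic subset of `X`: near every point of `X` it is the common zero set of finitely
many holomorphic functions. -/
def IsAnalyticSubset (A : Set X) : Prop :=
  ∀ x : X, ∃ U : Set X, IsOpen U ∧ x ∈ U ∧ ∃ (m : ℕ) (f : Fin m → X → ℂ),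
    (∀ i, MDifferentiableOn 𝓘(ℂ, E) 𝓘(ℂ, ℂ) (f i) U) ∧ A ∩ U = {y ∈ U | ∀ i, f i y = 0}

/-! ### The Christoffel-Darboux (Bergman) kernel -/

/-- The form `Hilb_k(h, μ)` on `H⁰(X, L^{⊗k})`. -/
def hilbForm [MeasurableSpace X] (h : HermitianMetric L) (μ : Measure X) {k : ℕ}
    (s t : H0 L E k) : ℂ :=
  ∫ x, h.powForm k x (s.1 x) (t.1 x) ∂μ

/-- The basis `b` of `H⁰(X, L^{⊗k})` is orthonormal for `Hilb_k(h, μ)`. -/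
def IsHilbOrthonormal [MeasurableSpace X] (h : HermitianMetric L) (μ : Measure X) {k : ℕ}
    (b : Module.Basis (Fin (h0 L E k)) ℂ (H0 L E k)) : Prop :=
  ∀ i j, hilbForm h μ (b i) (b j) = if i = j then 1 else 0

/-- The kernel `B_k(x, y) = ∑ s_i(x) s_i(y)^*` of a basis `s_i`, an element of
`L_x^{⊗k} ⊗ (L_y^{⊗k})^* = Hom(L_y^{⊗k}, L_x^{⊗k})`; here `s_i(y)^* = ⟨s_i(y), ·⟩`. -/
def bergmanKernel (h : HermitianMetric L) {k : ℕ}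
    (b : Module.Basis (Fin (h0 L E k)) ℂ (H0 L E k)) (x y : X) :
    (⨂[ℂ]^k (L y)) →ₗ[ℂ] (⨂[ℂ]^k (L x)) :=
  ∑ i, (h.powForm k y ((b i).1 y)).smulRight ((b i).1 x)

end HolomorphicLineBundles

/-! Write `f = s₁ / s₂` and let `P` be the orthogonal projection of `L²(μ₀)` onto `H⁰(X, L^{⊗k})`.
The kernel of the commutator `[f, P]` is `(f(x) - f(y)) B(x, y)`, so the double integral is its
square Hilbert-Schmidt norm. Expanding `|f(x) - f(y)|²` turns this norm into `2 tr Q`, where `Q = P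
|f|² P - (P f P)^* (P f P)`. The form of `Q` at a section `s` is the squared `L²` distance from `f
s` to the holomorphic sections.

Hence `0 ≤ Q ≤ M²`, where `M` bounds `|f|` on the support of `μ₀`, which is compact and avoids `s₂ =
0`. Moreover `Q` kills `s₂ · H⁰(X, L^{⊗(k-k₀)})`, since `f · s₂ r = s₁ r` is again holomorphic. So
`Q` has rank at most `n_k - n_{k-k₀}`, and its trace is at most `M²` times that. The core is
`integral_gram_mul_norm_sub_sq_le`; `mulSection` supplies the killed subspace.

Finite dimension follows from compactness and the Schwarz lemma. Definiteness of the `L²` form,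
which orthonormal bases require, holds because zero loci are analytic and no proper analytic set
contains the support. -/

/-! ### Local frames, continuity and products of sections -/

noncomputable section SectionsOfPowers

variable {X : Type*} [TopologicalSpace X]
  {L : X → Type*} [∀ x, AddCommGroup (L x)] [∀ x, Module ℂ (L x)]
  [TopologicalSpace (TotalSpace ℂ L)] [∀ x, TopologicalSpace (L x)]
  [FiberBundle ℂ L] [VectorBundle ℂ ℂ L]

variable (L) in
/-- The transition function from the frame `frameVec` at `x` to the local frame around `x₀`. -/
def frameTransition (x₀ x : X) : ℂ := (trivializationAt ℂ L x₀).linearMapAt ℂ x (frameVec L x)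

/-- The frame `frameVec L x` comes from a trivialization chosen anew at each `x`, so continuity and
holomorphy show only in the frame around a fixed `x₀`. This is the passage between the two. -/
theorem lineCoord_eq_frameTransition_pow_mul (k : ℕ) (x₀ x : X) (t : ⨂[ℂ]^k (L x)) :
    lineCoord L k x₀ x t = frameTransition L x₀ x ^ k * lineCoord L k x x t := by
  conv_lhs => rw [← lineCoord_smul_framePow L k x t, map_smul, smul_eq_mul, mul_comm]
  simp [lineCoord, framePow, tensorPowerFunctional_tprod, frameTransition]

theorem frameTransition_smul_symm {x₀ x : X} (hx : x ∈ (trivializationAt ℂ L x₀).baseSet) :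
    frameTransition L x₀ x • (trivializationAt ℂ L x₀).symm x (1 : ℂ) = frameVec L x := by
  have h1 := (trivializationAt ℂ L x₀).symmₗ_linearMapAt (R := ℂ) hx (frameVec L x)
  have h2 : (trivializationAt ℂ L x₀).symm x (1 : ℂ) =
      (trivializationAt ℂ L x₀).symmₗ ℂ x 1 := by simp [hx]
  rw [h2, ← map_smul, smul_eq_mul, mul_one, frameTransition, h1]

theorem frameTransition_ne_zero {x₀ x : X} (hx : x ∈ (trivializationAt ℂ L x₀).baseSet) :
    frameTransition L x₀ x ≠ 0 := by
  intro h
  have := frameTransition_smul_symm hx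
  rw [h, zero_smul] at this
  exact frameVec_ne_zero L x this.symm

theorem lineCoord_self_eq_zero_iff {k : ℕ} {x : X} {t : ⨂[ℂ]^k (L x)} :
    lineCoord L k x x t = 0 ↔ t = 0 := by
  refine ⟨fun h => ?_, fun h => by rw [h, map_zero]⟩
  rw [← lineCoord_smul_framePow L k x t, h, zero_smul]

theorem lineCoord_eq_zero_iff {k : ℕ} {x₀ x : X} (hx : x ∈ (trivializationAt ℂ L x₀).baseSet)
    {t : ⨂[ℂ]^k (L x)} : lineCoord L k x₀ x t = 0 ↔ t = 0 := by
  rw [lineCoord_eq_frameTransition_pow_mul, mul_eq_zero, lineCoord_self_eq_zero_iff]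
  exact or_iff_right (pow_ne_zero _ (frameTransition_ne_zero hx))

theorem lineCoord_injective {k : ℕ} {x : X} : Function.Injective (lineCoord L k x x) :=
  (injective_iff_map_eq_zero _).2 fun _ h => lineCoord_self_eq_zero_iff.1 h

/-- The square norm of the local frame around `x₀`. -/
def HermitianMetric.weight (h : HermitianMetric L) (x₀ x : X) : ℝ :=
  (h.form x ((trivializationAt ℂ L x₀).symm x (1 : ℂ))
    ((trivializationAt ℂ L x₀).symm x (1 : ℂ))).re

omit [VectorBundle ℂ ℂ L] in
theorem HermitianMetric.ofReal_weight (h : HermitianMetric L) (x₀ x : X) :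
    (h.weight x₀ x : ℂ) = h.form x ((trivializationAt ℂ L x₀).symm x (1 : ℂ))
      ((trivializationAt ℂ L x₀).symm x (1 : ℂ)) :=
  Complex.conj_eq_iff_re.mp (h.conj_symm x _ _)

theorem HermitianMetric.weight_pos (h : HermitianMetric L) {x₀ x : X}
    (hx : x ∈ (trivializationAt ℂ L x₀).baseSet) : 0 < h.weight x₀ x := by
  refine h.pos x _ fun h0 => frameVec_ne_zero L x ?_
  rw [← frameTransition_smul_symm hx, h0, smul_zero]

omit [VectorBundle ℂ ℂ L] in
theorem HermitianMetric.continuousOn_weight (h : HermitianMetric L) (x₀ : X) :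
    ContinuousOn (h.weight x₀) (trivializationAt ℂ L x₀).baseSet := by
  have h1 : ContinuousOn (fun x => TotalSpace.mk' ℂ x ((trivializationAt ℂ L x₀).symm x (1 : ℂ)))
      (trivializationAt ℂ L x₀).baseSet :=
    (trivializationAt ℂ L x₀).continuousOn_symm.comp
      (continuousOn_id.prodMk continuousOn_const) fun x hx => ⟨hx, Set.mem_univ _⟩
  exact Complex.continuous_re.comp_continuousOn (h.continuous_form.comp_continuousOn h1)

theorem HermitianMetric.powForm_eq_weight (h : HermitianMetric L) (k : ℕ) {x₀ x : X}
    (hx : x ∈ (trivializationAt ℂ L x₀).baseSet) (s t : ⨂[ℂ]^k (L x)) :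
    h.powForm k x s t =
      conj (lineCoord L k x₀ x s) * lineCoord L k x₀ x t * (h.weight x₀ x : ℂ) ^ k := by
  rw [powForm_apply, lineCoord_eq_frameTransition_pow_mul k x₀ x s,
    lineCoord_eq_frameTransition_pow_mul k x₀ x t, ← frameTransition_smul_symm hx,
    LinearMap.map_smul, LinearMap.map_smulₛₗ, LinearMap.smul_apply, h.ofReal_weight]
  simp only [smul_eq_mul, map_mul, map_pow]
  ring

theorem HermitianMetric.conj_powForm (h : HermitianMetric L) (k : ℕ) (x : X)
    (s t : ⨂[ℂ]^k (L x)) : conj (h.powForm k x s t) = h.powForm k x t s := by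
  rw [powForm_apply, powForm_apply]
  simp only [map_mul, map_pow, Complex.conj_conj, h.conj_symm]
  ring

/-- The fibre is a line, so the form is a product of one coordinate factor per argument, and
arguments can be swapped between two forms. -/
theorem HermitianMetric.powForm_mul_powForm (h : HermitianMetric L) (k : ℕ) (x : X)
    (s t u v : ⨂[ℂ]^k (L x)) :
    h.powForm k x s t * h.powForm k x u v = h.powForm k x s v * h.powForm k x u t := by
  simp only [powForm_apply]
  ring

theorem HermitianMetric.powForm_self (h : HermitianMetric L) (k : ℕ) (x : X)
    (s : ⨂[ℂ]^k (L x)) :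
    h.powForm k x s s = ((‖lineCoord L k x x s‖ ^ 2 * h.weight x x ^ k : ℝ) : ℂ) := by
  rw [powForm_eq_weight h k (FiberBundle.mem_baseSet_trivializationAt' (F := ℂ) (E := L) x),
    Complex.conj_mul']
  push_cast
  rfl

theorem HermitianMetric.powForm_self_eq_zero_iff (h : HermitianMetric L) {k : ℕ} {x : X}
    {s : ⨂[ℂ]^k (L x)} : h.powForm k x s s = 0 ↔ s = 0 := by
  refine ⟨fun h0 => ?_, fun h0 => by rw [h0, LinearMap.map_zero]⟩
  have hw := h.weight_pos (FiberBundle.mem_baseSet_trivializationAt' (F := ℂ) (E := L) x)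
  rw [powForm_self, Complex.ofReal_eq_zero, mul_eq_zero,
    or_iff_left (pow_ne_zero _ hw.ne'), sq_eq_zero_iff, norm_eq_zero] at h0
  exact lineCoord_self_eq_zero_iff.1 h0

theorem HermitianMetric.powForm_self_re_nonneg (h : HermitianMetric L) (k : ℕ) (x : X)
    (s : ⨂[ℂ]^k (L x)) : 0 ≤ (h.powForm k x s s).re := by
  have hw := h.weight_pos (FiberBundle.mem_baseSet_trivializationAt' (F := ℂ) (E := L) x)
  rw [powForm_self, Complex.ofReal_re]
  positivity

theorem HermitianMetric.ofReal_powForm_self_re (h : HermitianMetric L) (k : ℕ) (x : X)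
    (s : ⨂[ℂ]^k (L x)) : ((h.powForm k x s s).re : ℂ) = h.powForm k x s s :=
  Complex.conj_eq_iff_re.mp (h.conj_powForm k x s s)

variable {E : Type*} [NormedAddCommGroup E] [NormedSpace ℂ E] [ChartedSpace E X]

theorem continuousOn_lineCoord {k : ℕ} (s : H0 L E k) (x₀ : X) :
    ContinuousOn (fun x => lineCoord L k x₀ x (s.1 x)) (trivializationAt ℂ L x₀).baseSet :=
  (s.2 x₀).continuousOn

theorem HermitianMetric.continuous_powForm (h : HermitianMetric L) {k : ℕ} (s t : H0 L E k) :
    Continuous fun x => h.powForm k x (s.1 x) (t.1 x) := by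
  rw [continuous_iff_continuousAt]
  intro x₀
  have hU := (trivializationAt ℂ L x₀).open_baseSet.mem_nhds
    (FiberBundle.mem_baseSet_trivializationAt' (F := ℂ) (E := L) x₀)
  have h1 : ContinuousOn (fun x => conj (lineCoord L k x₀ x (s.1 x)) *
      lineCoord L k x₀ x (t.1 x) * (h.weight x₀ x : ℂ) ^ k)
      (trivializationAt ℂ L x₀).baseSet :=
    ((Complex.continuous_conj.comp_continuousOn (continuousOn_lineCoord s x₀)).mul
      (continuousOn_lineCoord t x₀)).mul
      ((Complex.continuous_ofReal.comp_continuousOn (h.continuousOn_weight x₀)).pow k)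
  refine (h1.congr fun x hx => ?_).continuousAt hU
  exact h.powForm_eq_weight k hx _ _

theorem isClosed_zeroLocus (h : HermitianMetric L) {k : ℕ} (s : H0 L E k) :
    IsClosed (zeroLocus s) := by
  have : zeroLocus s = {x | h.powForm k x (s.1 x) (s.1 x) = 0} := by
    ext x
    exact h.powForm_self_eq_zero_iff.symm
  rw [this]
  exact isClosed_eq (h.continuous_powForm s s) continuous_const

theorem isAnalyticSubset_zeroLocus {k : ℕ} (s : H0 L E k) : IsAnalyticSubset E (zeroLocus s) := by
  intro x
  refine ⟨(trivializationAt ℂ L x).baseSet, (trivializationAt ℂ L x).open_baseSet,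
    FiberBundle.mem_baseSet_trivializationAt' (F := ℂ) (E := L) x, 1,
    fun _ y => lineCoord L k x y (s.1 y), fun _ => s.2 x, ?_⟩
  ext y
  simp only [Set.mem_inter_iff, Set.mem_ofPred_eq, forall_const]
  constructor
  · rintro ⟨h1, h2⟩
    exact ⟨h2, (lineCoord_eq_zero_iff h2).2 h1⟩
  · rintro ⟨h1, h2⟩
    exact ⟨(lineCoord_eq_zero_iff h1).1 h2, h1⟩

theorem continuousOn_sectionRatio {k : ℕ} (s₁ s₂ : H0 L E k) :
    ContinuousOn (sectionRatio s₁ s₂) (zeroLocus s₂)ᶜ := by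
  intro x₀ hx₀
  have hx := FiberBundle.mem_baseSet_trivializationAt' (F := ℂ) (E := L) x₀
  have hU := (trivializationAt ℂ L x₀).open_baseSet.mem_nhds hx
  refine ContinuousAt.continuousWithinAt ?_
  have h1 : ContinuousAt (fun x => lineCoord L k x₀ x (s₁.1 x) / lineCoord L k x₀ x (s₂.1 x)) x₀ :=
    ((continuousOn_lineCoord s₁ x₀).continuousAt hU).div
      ((continuousOn_lineCoord s₂ x₀).continuousAt hU)
      fun h => hx₀ ((lineCoord_eq_zero_iff hx).1 h)
  refine h1.congr (Filter.eventuallyEq_of_mem hU fun x hx' => ?_)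
  rw [lineCoord_eq_frameTransition_pow_mul k x₀ x (s₁.1 x),
    lineCoord_eq_frameTransition_pow_mul k x₀ x (s₂.1 x), sectionRatio,
    mul_div_mul_left _ _ (pow_ne_zero _ (frameTransition_ne_zero hx'))]

/-- Multiplication by a section of `L^{⊗k}`, as a map `H⁰(X, L^{⊗m}) → H⁰(X, L^{⊗(k+m)})`. -/
def mulSection {k : ℕ} (s : H0 L E k) (m n : ℕ) (hn : k + m = n) : H0 L E m →ₗ[ℂ] H0 L E n where
  toFun r := ⟨fun x => (lineCoord L k x x (s.1 x) * lineCoord L m x x (r.1 x)) • framePow L n x,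
    -- Transition factors multiply, `g ^ k * g ^ m = g ^ (k + m)`, so in the frame around `x₀` the
    -- coordinate is the product of the two holomorphic coordinates.
    fun x₀ => ((s.2 x₀).mul (r.2 x₀)).congr fun x _ => by
      subst hn
      rw [map_smul, lineCoord_eq_frameTransition_pow_mul _ x₀ x (framePow L _ x),
        lineCoord_framePow, smul_eq_mul]
      simp only [Pi.mul_apply]
      rw [lineCoord_eq_frameTransition_pow_mul k x₀ x, lineCoord_eq_frameTransition_pow_mul m x₀ x]
      ring⟩
  map_add' r r' := by
    ext x
    simp [mul_add, add_smul]
  map_smul' c r := by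
    ext x
    simp [smul_smul, mul_left_comm]

theorem lineCoord_mulSection {k : ℕ} (s : H0 L E k) {m n : ℕ} (hn : k + m = n) (r : H0 L E m)
    (x : X) : lineCoord L n x x ((mulSection s m n hn r).1 x) =
      lineCoord L k x x (s.1 x) * lineCoord L m x x (r.1 x) := by
  change lineCoord L n x x ((_ : ℂ) • framePow L n x) = _
  rw [map_smul, lineCoord_framePow, smul_eq_mul, mul_one]

theorem sectionRatio_smul_mulSection {k : ℕ} (s₁ s₂ : H0 L E k) {m n : ℕ} (hn : k + m = n)
    (r : H0 L E m) {x : X} (hx : x ∉ zeroLocus s₂) :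
    sectionRatio s₁ s₂ x • (mulSection s₂ m n hn r).1 x = (mulSection s₁ m n hn r).1 x := by
  have h2 : lineCoord L k x x (s₂.1 x) ≠ 0 := fun h => hx (lineCoord_self_eq_zero_iff.1 h)
  apply lineCoord_injective
  rw [map_smul, lineCoord_mulSection, lineCoord_mulSection, sectionRatio, smul_eq_mul]
  field_simp

end SectionsOfPowers

/-! ### Finite dimension of the spaces of sections -/

noncomputable section FiniteDimensionality

open scoped Topology

variable {X : Type*} [TopologicalSpace X]
  {L : X → Type*} [∀ x, AddCommGroup (L x)] [∀ x, Module ℂ (L x)]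
  [TopologicalSpace (TotalSpace ℂ L)] [∀ x, TopologicalSpace (L x)]
  [FiberBundle ℂ L] [VectorBundle ℂ ℂ L]
variable {E : Type*} [NormedAddCommGroup E] [NormedSpace ℂ E] [ChartedSpace E X]

theorem HermitianMetric.powForm_self_re_eq_weight (h : HermitianMetric L) (k : ℕ) {x₀ x : X}
    (hx : x ∈ (trivializationAt ℂ L x₀).baseSet) (s : ⨂[ℂ]^k (L x)) :
    (h.powForm k x s s).re = ‖lineCoord L k x₀ x s‖ ^ 2 * h.weight x₀ x ^ k := by
  rw [h.powForm_eq_weight k hx, Complex.conj_mul', ← Complex.ofReal_pow, ← Complex.ofReal_pow,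
    ← Complex.ofReal_mul, Complex.ofReal_re]

/-- Schwarz lemma for sections: near a point `p`, sections vanishing at `p` are at most half as
large as their global maximum. -/
theorem HermitianMetric.exists_nhds_powForm_le_half [IsManifold 𝓘(ℂ, E) ω X]
    (h : HermitianMetric L) (k : ℕ) (p : X) :
    ∃ U ∈ 𝓝 p, ∀ s : H0 L E k, s.1 p = 0 → ∀ B : ℝ,
      (∀ x, (h.powForm k x (s.1 x) (s.1 x)).re ≤ B) →
      ∀ x ∈ U, (h.powForm k x (s.1 x) (s.1 x)).re ≤ B / 2 := by
  have : IsManifold 𝓘(ℂ, E) 1 X := IsManifold.of_le (n := ω) le_top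
  set φ := extChartAt 𝓘(ℂ, E) p with hφ
  have hp := FiberBundle.mem_baseSet_trivializationAt' (F := ℂ) (E := L) p
  have hbase := (trivializationAt ℂ L p).open_baseSet.mem_nhds hp
  have hc0 := h.weight_pos hp
  set c := h.weight p p with hc
  -- Near `p` the weight varies by a factor below `4`, which costs at most `4 ^ k` between metric
  -- norms and coordinates.
  have hV : {x | x ∈ (trivializationAt ℂ L p).baseSet ∧ c / 2 < h.weight p x ∧
      h.weight p x < 2 * c} ∈ 𝓝 p := by
    have hw := (h.continuousOn_weight p).continuousAt hbase
    filter_upwards [hbase, hw.eventually_const_lt (half_lt_self hc0),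
      hw.eventually_lt_const (show c < 2 * c by linarith)] with x h1 h2 h3
    exact ⟨h1, h2, h3⟩
  have hV' := (continuousAt_extChartAt_symm (I := 𝓘(ℂ, E)) p).preimage_mem_nhds
    (by rwa [extChartAt_to_inv])
  obtain ⟨r, hr, hball⟩ := Metric.mem_nhds_iff.1
    (Filter.inter_mem hV' (extChartAt_target_mem_nhds (I := 𝓘(ℂ, E)) p))
  -- On this smaller ball the Schwarz lemma gains `4 ^ (-(k + 1))` in the squared norm. This absorbs
  -- the loss `4 ^ k` and leaves `B / 4`.
  have hr' : 0 < r / 2 ^ (k + 1) := by positivity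
  refine ⟨φ.source ∩ φ ⁻¹' Metric.ball (φ p) (r / 2 ^ (k + 1)),
    Filter.inter_mem (extChartAt_source_mem_nhds p)
      ((continuousAt_extChartAt p).preimage_mem_nhds (Metric.ball_mem_nhds _ hr')), ?_⟩
  rintro s hs B hB x ⟨hxs, hxb⟩
  have hB0 : 0 ≤ B := (h.powForm_self_re_nonneg k p (s.1 p)).trans (hB p)
  have hck : 0 < (c / 2) ^ k := by positivity
  set f : E → ℂ := fun z => lineCoord L k p (φ.symm z) (s.1 (φ.symm z)) with hf
  have hfd : DifferentiableOn ℂ f (Metric.ball (φ p) r) := by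
    rw [← mdifferentiableOn_iff_differentiableOn]
    refine MDifferentiableOn.comp (s.2 p)
      ((mdifferentiableOn_extChartAt_symm (x := p)).mono fun z hz => (hball hz).2)
      fun z hz => (hball hz).1.1
  have hfp : f (φ p) = 0 := by
    have hpp : φ.symm (φ p) = p := extChartAt_to_inv p
    simp only [hf]
    rw [hpp, hs, map_zero]
  have hfB : ∀ z ∈ Metric.ball (φ p) r, ‖f z‖ ^ 2 ≤ B / (c / 2) ^ k := by
    intro z hz
    obtain ⟨h1, h2, h3⟩ := (hball hz).1
    have h4 := hB (φ.symm z)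
    rw [h.powForm_self_re_eq_weight k h1] at h4
    rw [le_div_iff₀ hck]
    refine le_trans ?_ h4
    gcongr
  have hmaps : Set.MapsTo f (Metric.ball (φ p) r)
      (Metric.closedBall (f (φ p)) (Real.sqrt (B / (c / 2) ^ k))) := by
    intro z hz
    rw [hfp, mem_closedBall_zero_iff]
    exact Real.le_sqrt_of_sq_le (hfB z hz)
  have hxb' : dist (φ x) (φ p) < r / 2 ^ (k + 1) := hxb
  have hxr : φ x ∈ Metric.ball (φ p) r := by
    refine Metric.mem_ball.2 (hxb'.trans_le (div_le_self hr.le ?_))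
    exact one_le_pow₀ (by norm_num)
  have hS := Complex.dist_le_div_mul_dist_of_mapsTo_ball hfd hmaps hxr
  rw [hfp, dist_zero_right] at hS
  have hx1 := (hball hxr).1
  have hinv : φ.symm (φ x) = x := φ.left_inv hxs
  simp only [Set.mem_preimage] at hx1
  rw [← hφ, hinv] at hx1
  obtain ⟨h1, h2, h3⟩ := hx1
  rw [h.powForm_self_re_eq_weight k h1]
  have hfx : f (φ x) = lineCoord L k p x (s.1 x) := by
    simp only [hf]
    rw [hinv]
  rw [← hfx]
  have hS2 : ‖f (φ x)‖ ≤ Real.sqrt (B / (c / 2) ^ k) * (1 / 2 ^ (k + 1)) := by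
    refine hS.trans ?_
    rw [div_mul_eq_mul_div, mul_div_assoc]
    refine mul_le_mul_of_nonneg_left ?_ (Real.sqrt_nonneg _)
    rw [div_le_iff₀ hr]
    calc dist (φ x) (φ p) ≤ r / 2 ^ (k + 1) := hxb'.le
      _ = _ := by ring
  have hw0 : 0 < h.weight p x := h.weight_pos h1
  calc ‖f (φ x)‖ ^ 2 * h.weight p x ^ k
      ≤ (Real.sqrt (B / (c / 2) ^ k) * (1 / 2 ^ (k + 1))) ^ 2 * (2 * c) ^ k := by gcongr
    _ = B * (1 / 4) := by
        rw [mul_pow, Real.sq_sqrt (by positivity), div_pow c, mul_pow 2 c, pow_succ (2 : ℝ) k]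
        have h2k : (2 : ℝ) ^ k ≠ 0 := by positivity
        have hck' : c ^ k ≠ 0 := by positivity
        generalize (2 : ℝ) ^ k = a at *
        generalize c ^ k = d at *
        field_simp
        norm_num
    _ ≤ B / 2 := by linarith

/-- Finitely many of the Schwarz neighbourhoods cover `X`. A section vanishing at their centres has
a maximal squared norm that is at most half of itself, hence is zero; so evaluation at the centres
is injective. -/
theorem finiteDimensional_H0 [CompactSpace X] [IsManifold 𝓘(ℂ, E) ω X]
    (h : HermitianMetric L) (k : ℕ) : FiniteDimensional ℂ (H0 L E k) := by
  choose U hU hUs using fun p => h.exists_nhds_powForm_le_half (E := E) k p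
  obtain ⟨t, -, ht⟩ := isCompact_univ.elim_nhds_subcover U fun x _ => hU x
  let ev : H0 L E k →ₗ[ℂ] (t → ℂ) :=
    LinearMap.pi fun p => lineCoord L k p.1 p.1 ∘ₗ LinearMap.proj p.1 ∘ₗ (H0 L E k).subtype
  refine FiniteDimensional.of_injective ev ((injective_iff_map_eq_zero _).2 fun s hs => ?_)
  have hs0 : ∀ p ∈ t, s.1 p = 0 := fun p hp => lineCoord_self_eq_zero_iff.1 (congrFun hs ⟨p, hp⟩)
  ext x
  obtain ⟨y, -, hy⟩ := isCompact_univ.exists_isMaxOn ⟨x, Set.mem_univ x⟩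
    (Complex.continuous_re.comp (h.continuous_powForm s s)).continuousOn
  have hmax : ∀ z, (h.powForm k z (s.1 z) (s.1 z)).re ≤ (h.powForm k y (s.1 y) (s.1 y)).re :=
    fun z => hy (Set.mem_univ z)
  obtain ⟨p, hp, hyp⟩ := Set.mem_iUnion₂.1 (ht (Set.mem_univ y))
  have h1 := hUs p s (hs0 p hp) _ hmax y hyp
  have h2 : (h.powForm k x (s.1 x) (s.1 x)).re = 0 :=
    le_antisymm ((hmax x).trans (by linarith)) (h.powForm_self_re_nonneg k x _)
  refine h.powForm_self_eq_zero_iff.1 ?_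
  rw [← h.ofReal_powForm_self_re, h2, Complex.ofReal_zero]

end FiniteDimensionality

/-! ### Positive definiteness of the `L²` form -/

noncomputable section OrthonormalBases

variable {X : Type*} [TopologicalSpace X]
  {L : X → Type*} [∀ x, AddCommGroup (L x)] [∀ x, Module ℂ (L x)]
  [TopologicalSpace (TotalSpace ℂ L)] [∀ x, TopologicalSpace (L x)]
  [FiberBundle ℂ L] [VectorBundle ℂ ℂ L]
variable {E : Type*} [NormedAddCommGroup E] [NormedSpace ℂ E] [ChartedSpace E X]

theorem HermitianMetric.integrable_powForm [CompactSpace X] [MeasurableSpace X] [BorelSpace X]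
    (h : HermitianMetric L) (μ : Measure X) [IsFiniteMeasure μ] {k : ℕ} (s t : H0 L E k) :
    Integrable (fun x => h.powForm k x (s.1 x) (t.1 x)) μ :=
  (h.continuous_powForm s t).integrable_of_hasCompactSupport (HasCompactSupport.of_compactSpace _)

theorem eq_zero_of_support_subset_zeroLocus [MeasurableSpace X] {μ : Measure X}
    (hsupp : ∀ A : Set X, IsAnalyticSubset E A → μ.support ⊆ A → A = Set.univ) {k : ℕ}
    (s : H0 L E k) (hs : μ.support ⊆ zeroLocus s) : s = 0 := by
  have h1 := hsupp _ (isAnalyticSubset_zeroLocus s) hs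
  ext x
  exact h1.ge (Set.mem_univ x)

variable [CompactSpace X] [MeasurableSpace X] [BorelSpace X]

/-- A nonnegative integrand with zero integral vanishes almost everywhere. The zero locus is then
closed and conull, so it contains the support. -/
theorem eq_zero_of_hilbForm_self_eq_zero (h : HermitianMetric L) (μ : Measure X)
    [IsFiniteMeasure μ]
    (hsupp : ∀ A : Set X, IsAnalyticSubset E A → μ.support ⊆ A → A = Set.univ) {k : ℕ}
    (s : H0 L E k) (hs : hilbForm h μ s s = 0) : s = 0 := by
  refine eq_zero_of_support_subset_zeroLocus hsupp s
    (Measure.support_subset_of_isClosed (isClosed_zeroLocus h s) ?_)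
  have h1 : ∫ x, (h.powForm k x (s.1 x) (s.1 x)).re ∂μ = 0 := by
    have h2 := integral_re (h.integrable_powForm μ s s)
    rw [hilbForm] at hs
    rw [hs] at h2
    simpa using h2
  rw [integral_eq_zero_iff_of_nonneg (fun x => h.powForm_self_re_nonneg k x _)
    (h.integrable_powForm μ s s).re] at h1
  filter_upwards [h1] with x hx
  refine h.powForm_self_eq_zero_iff.1 ?_
  rw [← h.ofReal_powForm_self_re, hx, Pi.zero_apply, Complex.ofReal_zero]

theorem exists_isHilbOrthonormal [IsManifold 𝓘(ℂ, E) ω X] (h : HermitianMetric L) (μ : Measure X)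
    [IsFiniteMeasure μ]
    (hsupp : ∀ A : Set X, IsAnalyticSubset E A → μ.support ⊆ A → A = Set.univ) (k : ℕ) :
    ∃ b : Module.Basis (Fin (h0 L E k)) ℂ (H0 L E k), IsHilbOrthonormal h μ b := by
  have := finiteDimensional_H0 (E := E) h k
  let core : InnerProductSpace.Core ℂ (H0 L E k) :=
    { inner := fun s t => hilbForm h μ s t
      conj_inner_symm := fun s t => by
        simp only [hilbForm]
        rw [← integral_conj]
        simp only [h.conj_powForm]
      re_inner_nonneg := fun s => by
        have h2 := integral_re (h.integrable_powForm μ s s)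
        change 0 ≤ RCLike.re (hilbForm h μ s s)
        rw [hilbForm, ← h2]
        exact integral_nonneg fun x => h.powForm_self_re_nonneg k x _
      add_left := fun s t u => by
        simp only [hilbForm]
        rw [← integral_add (h.integrable_powForm μ s u) (h.integrable_powForm μ t u)]
        simp
      smul_left := fun s t c => by
        simp only [hilbForm]
        rw [← integral_const_mul]
        simp
      definite := fun s hs => eq_zero_of_hilbForm_self_eq_zero h μ hsupp s hs }
  let _ : NormedAddCommGroup (H0 L E k) := core.toNormedAddCommGroup
  let _ : InnerProductSpace ℂ (H0 L E k) := InnerProductSpace.ofCore core.toCore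
  refine ⟨(stdOrthonormalBasis ℂ (H0 L E k)).toBasis, fun i j => ?_⟩
  have := orthonormal_iff_ite.1 (stdOrthonormalBasis ℂ (H0 L E k)).orthonormal i j
  rw [← OrthonormalBasis.coe_toBasis] at this
  exact this

end OrthonormalBases

/-! ### Trace and rank of positive semidefinite matrices -/

-- The trace is the sum of the nonzero eigenvalues. There are `rank` many, each at most `c` by
-- testing on a unit eigenvector.
open scoped ComplexOrder in
theorem Matrix.PosSemidef.re_trace_le_mul_rank {n : Type*} [Fintype n] [DecidableEq n]
    {Q : Matrix n n ℂ} (hQ : Q.PosSemidef) {c : ℝ}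
    (hc : ∀ x : n → ℂ, (star x ⬝ᵥ Q.mulVec x).re ≤ c * (star x ⬝ᵥ x).re) :
    Q.trace.re ≤ c * Q.rank := by
  classical
  have hH := hQ.isHermitian
  have hev : ∀ i, hH.eigenvalues i ≤ c := by
    intro i
    have h1 := hc (hH.eigenvectorBasis i)
    rw [hH.mulVec_eigenvectorBasis i] at h1
    have h2 : (star (⇑(hH.eigenvectorBasis i)) ⬝ᵥ ⇑(hH.eigenvectorBasis i)) = (1 : ℂ) := by
      have := hH.eigenvectorBasis.orthonormal.1 i
      have h3 := inner_self_eq_norm_sq_to_K (𝕜 := ℂ) (hH.eigenvectorBasis i)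
      rw [this] at h3
      rw [EuclideanSpace.inner_eq_star_dotProduct, dotProduct_comm] at h3
      simpa using h3
    simp only [dotProduct_smul, h2] at h1
    simpa using h1
  rw [hH.trace_eq_sum_eigenvalues, hH.rank_eq_card_non_zero_eigs, Fintype.card_subtype]
  simp only [Complex.re_sum]
  rw [← Finset.sum_filter_add_sum_filter_not Finset.univ (fun i => hH.eigenvalues i ≠ 0)]
  rw [Finset.sum_eq_zero (s := Finset.univ.filter fun i => ¬ hH.eigenvalues i ≠ 0), add_zero]
  · rw [mul_comm, ← nsmul_eq_mul]
    exact Finset.sum_le_card_nsmul _ _ _ fun i _ => by simpa using hev i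
  · intro i hi
    have : hH.eigenvalues i = 0 := by simpa using hi
    simp [this]

-- For a positive semidefinite matrix, a null vector of the quadratic form lies in the kernel, so
-- `W` lowers the rank by its dimension.
open scoped ComplexOrder in
theorem Matrix.PosSemidef.re_trace_le_of_vanishing {n : Type*} [Fintype n] [DecidableEq n]
    {Q : Matrix n n ℂ} (hQ : Q.PosSemidef) {c : ℝ} (hc0 : 0 ≤ c)
    (hc : ∀ x : n → ℂ, (star x ⬝ᵥ Q.mulVec x).re ≤ c * (star x ⬝ᵥ x).re)
    (W : Submodule ℂ (n → ℂ)) (hW : ∀ x ∈ W, star x ⬝ᵥ Q.mulVec x = 0) :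
    Q.trace.re ≤ c * ((Fintype.card n : ℝ) - Module.finrank ℂ W) := by
  refine (hQ.re_trace_le_mul_rank hc).trans (mul_le_mul_of_nonneg_left ?_ hc0)
  have h1 : W ≤ LinearMap.ker Q.mulVecLin := fun x hx =>
    (hQ.dotProduct_mulVec_zero_iff x).1 (hW x hx)
  have h2 := Submodule.finrank_mono h1
  have h3 := LinearMap.finrank_range_add_finrank_ker Q.mulVecLin
  rw [Module.finrank_fintype_fun_eq_card] at h3
  have h4 : Q.rank = Module.finrank ℂ (LinearMap.range Q.mulVecLin) := rfl
  have h5 : Q.rank + Module.finrank ℂ W ≤ Fintype.card n := by omega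
  have h6 : (Q.rank : ℝ) + Module.finrank ℂ W ≤ Fintype.card n := by exact_mod_cast h5
  linarith

/-! ### The Hilbert-Schmidt norm of the commutator -/

section CommutatorKernel

variable {X n : Type*} [MeasurableSpace X] [Fintype n] [DecidableEq n] {μ : Measure X}

open scoped ComplexOrder in
/-- Let `G i j` be the Gram functions of an orthonormal family and `f` a bounded multiplier. If `W`
is a space of coefficient vectors whose combinations are mapped into the span of the family by `f`,
then the commutator of `f` with the projection onto the span has square Hilbert-Schmidt norm at
most `2 M² codim W`. -/
theorem integral_gram_mul_norm_sub_sq_le [SFinite μ] {G : n → n → X → ℂ}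
    (hG : ∀ i j, Integrable (G i j) μ) (hconj : ∀ i j p, conj (G i j p) = G j i p)
    (hpos : ∀ p (c : n → ℂ), 0 ≤ ∑ i, ∑ j, conj (c i) * c j * G i j p)
    (hON : ∀ i j, ∫ p, G i j p ∂μ = if i = j then 1 else 0)
    {f : X → ℂ} (hf : AEStronglyMeasurable f μ) {M : ℝ} (hM : ∀ᵐ p ∂μ, ‖f p‖ ≤ M)
    (W : Submodule ℂ (n → ℂ))
    (hW : ∀ x ∈ W, ∃ y : n → ℂ, ∀ᵐ p ∂μ,
      ∑ i, ∑ j, conj (f p * x i - y i) * (f p * x j - y j) * G i j p = 0) :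
    Integrable (fun p : X × X => (∑ i, ∑ j, G i j p.1 * G j i p.2) *
      (‖f p.1 - f p.2‖ ^ 2 : ℝ)) (μ.prod μ) ∧
    (∫ p : X × X, (∑ i, ∑ j, G i j p.1 * G j i p.2) *
      (‖f p.1 - f p.2‖ ^ 2 : ℝ) ∂(μ.prod μ)).re ≤
        2 * M ^ 2 * ((Fintype.card n : ℝ) - Module.finrank ℂ W) := by
  have hfG : ∀ i j, Integrable (fun p => f p * G i j p) μ := fun i j => (hG i j).bdd_mul hf hM
  have hcG : ∀ i j, Integrable (fun p => conj (f p) * G i j p) μ := fun i j =>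
    (hG i j).bdd_mul (Complex.continuous_conj.comp_aestronglyMeasurable hf)
      (by filter_upwards [hM] with p hp; simpa using hp)
  have hsG : ∀ i j, Integrable (fun p => conj (f p) * f p * G i j p) μ := fun i j => by
    simpa only [mul_assoc] using (hfG i j).bdd_mul
      (Complex.continuous_conj.comp_aestronglyMeasurable hf) (c := M)
      (by filter_upwards [hM] with p hp; simpa using hp)
  -- `A` and `F` are the compressions of `|f|²` and `f` to the span of the family.
  set A : Matrix n n ℂ := Matrix.of fun i j => ∫ p, conj (f p) * f p * G i j p ∂μ with hA
  set F : Matrix n n ℂ := Matrix.of fun i j => ∫ p, f p * G i j p ∂μ with hF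
  have hFH : ∀ i j, F.conjTranspose i j = ∫ p, conj (f p) * G i j p ∂μ := by
    intro i j
    rw [Matrix.conjTranspose_apply, hF, Matrix.of_apply]
    change conj _ = _
    rw [← integral_conj]
    simp only [map_mul, hconj]
  set Q := A - F.conjTranspose * F with hQ
  have hQH : Q.IsHermitian := by
    refine Matrix.IsHermitian.sub ?_ (Matrix.isHermitian_conjTranspose_mul_self F)
    ext i j
    rw [Matrix.conjTranspose_apply, hA, Matrix.of_apply, Matrix.of_apply]
    change conj _ = _
    rw [← integral_conj]
    simp only [map_mul, hconj, Complex.conj_conj, mul_comm (f _)]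
  set D : (n → ℂ) → (n → ℂ) → X → ℂ := fun x y p =>
    ∑ i, ∑ j, conj (f p * x i - y i) * (f p * x j - y j) * G i j p with hD
  have hDterm : ∀ (x y : n → ℂ) i j, (fun p => conj (f p * x i - y i) * (f p * x j - y j) * G i j p)
      = fun p => conj (x i) * x j * (conj (f p) * f p * G i j p)
        - conj (x i) * y j * (conj (f p) * G i j p)
        - conj (y i) * x j * (f p * G i j p) + conj (y i) * y j * G i j p := by
    intro x y i j
    ext p
    simp only [map_sub, map_mul]
    ring
  have hDterm_int : ∀ (x y : n → ℂ) i j,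
      Integrable (fun p => conj (f p * x i - y i) * (f p * x j - y j) * G i j p) μ := by
    intro x y i j
    rw [hDterm]
    exact ((((hsG i j).const_mul _).sub ((hcG i j).const_mul _)).sub
      ((hfG i j).const_mul _)).add ((hG i j).const_mul _)
  have hDint : ∀ x y, Integrable (D x y) μ := fun x y =>
    integrable_finsetSum _ fun i _ => integrable_finsetSum _ fun j _ => hDterm_int x y i j
  -- Pythagoras: `D x y` is the pointwise squared norm of `f s_x - s_y`, and `F x` holds the
  -- coordinates of the projection of `f s_x`. Below, `y = F x` gives positivity of `Q`, `y = 0`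
  -- gives the bound `M ^ 2`, and the `y` of `hW` gives vanishing on `W`.
  have hDeq : ∀ x y : n → ℂ, ∫ p, D x y p ∂μ = star x ⬝ᵥ Q.mulVec x +
      star (y - F.mulVec x) ⬝ᵥ (y - F.mulVec x) := by
    intro x y
    have h1 : ∫ p, D x y p ∂μ = star x ⬝ᵥ A.mulVec x - star x ⬝ᵥ F.conjTranspose.mulVec y
        - star y ⬝ᵥ F.mulVec x + star y ⬝ᵥ (1 : Matrix n n ℂ).mulVec y := by
      simp only [hD]
      rw [integral_finsetSum _ fun i _ => integrable_finsetSum _ fun j _ => hDterm_int x y i j]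
      simp only [dotProduct, Matrix.mulVec, Finset.mul_sum, ← Finset.sum_sub_distrib,
        ← Finset.sum_add_distrib]
      refine Finset.sum_congr rfl fun i _ => ?_
      rw [integral_finsetSum _ fun j _ => hDterm_int x y i j]
      refine Finset.sum_congr rfl fun j _ => ?_
      rw [hDterm, integral_add, integral_sub, integral_sub, integral_const_mul, integral_const_mul,
        integral_const_mul, integral_const_mul, hON, hFH, Matrix.one_apply, hA, hF,
        Matrix.of_apply, Matrix.of_apply]
      · simp only [Pi.star_apply, RCLike.star_def]
        ring
      · exact (hsG i j).const_mul _
      · exact (hcG i j).const_mul _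
      · exact ((hsG i j).const_mul _).sub ((hcG i j).const_mul _)
      · exact (hfG i j).const_mul _
      · exact (((hsG i j).const_mul _).sub ((hcG i j).const_mul _)).sub ((hfG i j).const_mul _)
      · exact (hG i j).const_mul _
    have h2 : ∀ z : n → ℂ, star x ⬝ᵥ F.conjTranspose.mulVec z = star (F.mulVec x) ⬝ᵥ z := by
      intro z
      rw [Matrix.star_mulVec, Matrix.dotProduct_mulVec]
    rw [h1, hQ, Matrix.sub_mulVec, dotProduct_sub, ← Matrix.mulVec_mulVec, h2, h2, star_sub,
      sub_dotProduct, dotProduct_sub, dotProduct_sub, Matrix.one_mulVec]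
    ring
  have hDnonneg : ∀ x y, 0 ≤ ∫ p, D x y p ∂μ := by
    intro x y
    have h1 : ∀ p, 0 ≤ D x y p := fun p => hpos p fun i => f p * x i - y i
    exact integral_nonneg h1
  have hQpos : Q.PosSemidef := by
    refine Matrix.PosSemidef.of_dotProduct_mulVec_nonneg hQH fun x => ?_
    have := hDnonneg x (F.mulVec x)
    rwa [hDeq, sub_self, dotProduct_zero, add_zero] at this
  have hstar : ∀ z : n → ℂ, 0 ≤ (star z ⬝ᵥ z).re := fun z =>
    (Complex.nonneg_iff.1 (dotProduct_star_self_nonneg z)).1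
  have hQle : ∀ x : n → ℂ, (star x ⬝ᵥ Q.mulVec x).re ≤ M ^ 2 * (star x ⬝ᵥ x).re := by
    intro x
    have h1 : (star x ⬝ᵥ Q.mulVec x).re ≤ (∫ p, D x 0 p ∂μ).re := by
      rw [hDeq, Complex.add_re]
      exact le_add_of_nonneg_right (hstar _)
    have hN : ∀ i j, Integrable (fun p => conj (x i) * x j * G i j p) μ :=
      fun i j => (hG i j).const_mul _
    have hNint : Integrable (fun p => ∑ i, ∑ j, conj (x i) * x j * G i j p) μ :=
      integrable_finsetSum _ fun i _ => integrable_finsetSum _ fun j _ => hN i j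
    have h2 : ∫ p, ∑ i, ∑ j, conj (x i) * x j * G i j p ∂μ = star x ⬝ᵥ x := by
      rw [integral_finsetSum _ fun i _ => integrable_finsetSum _ fun j _ => hN i j]
      refine Finset.sum_congr rfl fun i _ => ?_
      rw [integral_finsetSum _ fun j _ => hN i j]
      simp [integral_const_mul, hON]
    have h3 : ∀ p, D x 0 p = ((‖f p‖ ^ 2 : ℝ) : ℂ) * ∑ i, ∑ j, conj (x i) * x j * G i j p := by
      intro p
      simp only [hD, Finset.mul_sum, Complex.ofReal_pow, ← Complex.conj_mul', Pi.zero_apply,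
        sub_zero, map_mul]
      refine Finset.sum_congr rfl fun i _ => Finset.sum_congr rfl fun j _ => ?_
      ring
    refine h1.trans ?_
    rw [← h2]
    have h4 := integral_re (hDint x 0)
    have h5 := integral_re hNint
    simp only [RCLike.re_to_complex] at h4 h5
    rw [← h4, ← h5, ← integral_const_mul]
    refine integral_mono_ae (hDint x 0).re (hNint.re.const_mul _) ?_
    filter_upwards [hM] with p hp
    simp only [h3, Complex.re_ofReal_mul]
    exact mul_le_mul_of_nonneg_right (by gcongr) (Complex.nonneg_iff.1 (hpos p x)).1
  have hQW : ∀ x ∈ W, star x ⬝ᵥ Q.mulVec x = 0 := by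
    intro x hx
    obtain ⟨y, hy⟩ := hW x hx
    have h1 : ∫ p, D x y p ∂μ = 0 := integral_eq_zero_of_ae hy
    rw [hDeq] at h1
    have h2 := hQpos.dotProduct_mulVec_nonneg x
    have h3 := hstar (y - F.mulVec x)
    have h4 := congrArg Complex.re h1
    rw [Complex.add_re, Complex.zero_re] at h4
    obtain ⟨h5, h6⟩ := Complex.nonneg_iff.1 h2
    exact Complex.ext (by rw [Complex.zero_re]; linarith) h6.symm
  have htr := hQpos.re_trace_le_of_vanishing (sq_nonneg M) hQle W hQW
  have hterm : ∀ i j, (fun p : X × X => G i j p.1 * G j i p.2 * (‖f p.1 - f p.2‖ ^ 2 : ℝ)) =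
      fun p => (conj (f p.1) * f p.1 * G i j p.1) * G j i p.2
        - (f p.1 * G i j p.1) * (conj (f p.2) * G j i p.2)
        - (conj (f p.1) * G i j p.1) * (f p.2 * G j i p.2)
        + G i j p.1 * (conj (f p.2) * f p.2 * G j i p.2) := by
    intro i j
    ext p
    rw [Complex.ofReal_pow, ← Complex.conj_mul', map_sub]
    ring
  have hi1 := fun i j => (hsG i j).mul_prod (hG j i)
  have hi2 := fun i j => (hfG i j).mul_prod (hcG j i)
  have hi3 := fun i j => (hcG i j).mul_prod (hfG j i)
  have hi4 := fun i j => (hG i j).mul_prod (hsG j i)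
  have hterm_int : ∀ i j, Integrable
      (fun p : X × X => G i j p.1 * G j i p.2 * (‖f p.1 - f p.2‖ ^ 2 : ℝ)) (μ.prod μ) := by
    intro i j
    rw [hterm]
    exact (((hi1 i j).sub (hi2 i j)).sub (hi3 i j)).add (hi4 i j)
  simp only [Finset.sum_mul]
  refine ⟨integrable_finsetSum _ fun i _ => integrable_finsetSum _ fun j _ => hterm_int i j, ?_⟩
  -- By Fubini and orthonormality, each of the two square terms gives `tr A` and each of the two
  -- cross terms gives `-tr (F^* F)`.
  have hint : ∫ p : X × X, ∑ i, ∑ j, G i j p.1 * G j i p.2 * (‖f p.1 - f p.2‖ ^ 2 : ℝ) ∂(μ.prod μ)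
      = 2 * Q.trace := by
    have h1 : 2 * Q.trace = ∑ i, ∑ j, (A i j * (if j = i then 1 else 0) -
        F i j * F.conjTranspose j i - F.conjTranspose i j * F j i +
        (if i = j then 1 else 0) * A j i) := by
      have h2 : ∑ i, ∑ j, F i j * F.conjTranspose j i = (F.conjTranspose * F).trace := by
        rw [Matrix.trace_mul_comm]
        simp [Matrix.trace, Matrix.mul_apply]
      have h3 : ∑ i, ∑ j, F.conjTranspose i j * F j i = (F.conjTranspose * F).trace := by
        simp [Matrix.trace, Matrix.mul_apply]
      simp only [Finset.sum_add_distrib, Finset.sum_sub_distrib, h2, h3]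
      rw [hQ, Matrix.trace_sub]
      simp [Matrix.trace]
      ring
    rw [h1, integral_finsetSum _ fun i _ => integrable_finsetSum _ fun j _ => hterm_int i j]
    refine Finset.sum_congr rfl fun i _ => ?_
    rw [integral_finsetSum _ fun j _ => hterm_int i j]
    refine Finset.sum_congr rfl fun j _ => ?_
    rw [hterm, integral_add, integral_sub, integral_sub,
      integral_prod_mul (fun p => conj (f p) * f p * G i j p) (G j i),
      integral_prod_mul (fun p => f p * G i j p) (fun p => conj (f p) * G j i p),
      integral_prod_mul (fun p => conj (f p) * G i j p) (fun p => f p * G j i p),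
      integral_prod_mul (G i j) (fun p => conj (f p) * f p * G j i p), hON, hON, hFH, hFH]
    · rfl
    · exact hi1 i j
    · exact hi2 i j
    · exact (hi1 i j).sub (hi2 i j)
    · exact hi3 i j
    · exact ((hi1 i j).sub (hi2 i j)).sub (hi3 i j)
    · exact hi4 i j
  rw [hint]
  have : (2 * Q.trace).re = 2 * Q.trace.re := by simp
  rw [this, mul_assoc]
  exact mul_le_mul_of_nonneg_left htr (by norm_num)

end CommutatorKernel

/-! ### Application to the Christoffel-Darboux kernel -/

noncomputable section KernelBound

variable {X : Type*} [TopologicalSpace X]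
  {L : X → Type*} [∀ x, AddCommGroup (L x)] [∀ x, Module ℂ (L x)]
  [TopologicalSpace (TotalSpace ℂ L)] [∀ x, TopologicalSpace (L x)]
  [FiberBundle ℂ L] [VectorBundle ℂ ℂ L]
variable {E : Type*} [NormedAddCommGroup E] [NormedSpace ℂ E] [ChartedSpace E X]

theorem HermitianMetric.powForm_sum_smul (h : HermitianMetric L) (k : ℕ) (x : X) {n : Type*}
    [Fintype n] (c : n → ℂ) (v : n → ⨂[ℂ]^k (L x)) :
    h.powForm k x (∑ i, c i • v i) (∑ j, c j • v j) =
      ∑ i, ∑ j, conj (c i) * c j * h.powForm k x (v i) (v j) := by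
  simp only [map_sum, LinearMap.sum_apply, LinearMap.map_smulₛₗ, LinearMap.smul_apply,
    smul_eq_mul, Finset.mul_sum, RingHom.id_apply]
  rw [Finset.sum_comm]
  refine Finset.sum_congr rfl fun i _ => Finset.sum_congr rfl fun j _ => ?_
  ring

/-- Puts the kernel in the Gram form of `integral_gram_mul_norm_sub_sq_le`. The norm is tested on
the frame at `y`, which `powForm_mul_powForm` then splits off as a common factor. -/
theorem HermitianMetric.homNorm_bergmanKernel_sq (h : HermitianMetric L) {k : ℕ}
    (b : Module.Basis (Fin (h0 L E k)) ℂ (H0 L E k)) (x y : X) :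
    ((h.homNorm k x y (bergmanKernel h b x y) ^ 2 : ℝ) : ℂ) =
      ∑ i, ∑ j, h.powForm k x ((b i).1 x) ((b j).1 x) * h.powForm k y ((b j).1 y) ((b i).1 y) := by
  have hpos := h.powNorm_framePow_pos k y
  have hsq : ∀ (z : X) (t : ⨂[ℂ]^k (L z)), ((h.powNorm k z t ^ 2 : ℝ) : ℂ) = h.powForm k z t t := by
    intro z t
    rw [HermitianMetric.powNorm, Real.sq_sqrt (h.powForm_self_re_nonneg k z t),
      h.ofReal_powForm_self_re]
  rw [HermitianMetric.homNorm, div_pow, Complex.ofReal_div, hsq, hsq, div_eq_iff]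
  · have hT : bergmanKernel h b x y (framePow L k y) =
        ∑ i, h.powForm k y ((b i).1 y) (framePow L k y) • (b i).1 x := by
      simp [bergmanKernel]
    rw [hT, h.powForm_sum_smul, Finset.sum_mul]
    refine Finset.sum_congr rfl fun i _ => ?_
    rw [Finset.sum_mul]
    refine Finset.sum_congr rfl fun j _ => ?_
    rw [h.conj_powForm, h.powForm_mul_powForm]
    ring
  · rw [← hsq]
    exact_mod_cast (pow_pos hpos 2).ne'

theorem continuousOn_support_sectionRatio [MeasurableSpace X] {μ : Measure X} {k : ℕ}
    (s₁ s₂ : H0 L E k) (hdisj : Disjoint μ.support (zeroLocus s₂)) :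
    ContinuousOn (sectionRatio s₁ s₂) μ.support :=
  (continuousOn_sectionRatio s₁ s₂).mono hdisj.subset_compl_right

variable [CompactSpace X] [MeasurableSpace X] [BorelSpace X] [SecondCountableTopology X]

omit [CompactSpace X] in
theorem aestronglyMeasurable_sectionRatio {μ : Measure X} {k : ℕ}
    (s₁ s₂ : H0 L E k) (hdisj : Disjoint μ.support (zeroLocus s₂)) :
    AEStronglyMeasurable (sectionRatio s₁ s₂) μ := by
  have h1 := (continuousOn_support_sectionRatio s₁ s₂ hdisj).aestronglyMeasurable (μ := μ)
    Measure.isClosed_support.measurableSet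
  have h2 : ∀ᵐ x ∂μ, x ∈ μ.support := Measure.support_mem_ae
  rwa [Measure.restrict_eq_self_of_ae_mem h2] at h1

omit [BorelSpace X] in
theorem exists_ae_norm_sectionRatio_le (μ : Measure X) {k : ℕ}
    (s₁ s₂ : H0 L E k) (hdisj : Disjoint μ.support (zeroLocus s₂)) :
    ∃ M : ℝ, ∀ᵐ x ∂μ, ‖sectionRatio s₁ s₂ x‖ ≤ M := by
  obtain ⟨M, hM⟩ := Measure.isClosed_support.isCompact.exists_bound_of_continuousOn
    (continuousOn_support_sectionRatio s₁ s₂ hdisj)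
  exact ⟨M, Filter.mem_of_superset Measure.support_mem_ae hM⟩

-- Since `s` has no zeros on the support, `s r = 0` forces `r` to vanish there, hence everywhere.
omit [SecondCountableTopology X] [CompactSpace X] [BorelSpace X] in
theorem mulSection_injective {μ : Measure X} {k m n : ℕ} (hn : k + m = n) (s : H0 L E k)
    (hdisj : Disjoint μ.support (zeroLocus s))
    (hsupp : ∀ A : Set X, IsAnalyticSubset E A → μ.support ⊆ A → A = Set.univ) :
    Function.Injective (mulSection s m n hn) := by
  refine (injective_iff_map_eq_zero _).2 fun r hr => ?_
  refine eq_zero_of_support_subset_zeroLocus hsupp r fun x hx => ?_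
  have h1 : s.1 x ≠ 0 := fun h => Set.disjoint_left.1 hdisj hx h
  have h2 := lineCoord_mulSection s hn r x
  rw [hr] at h2
  have h3 : lineCoord L n x x ((0 : H0 L E n).1 x) = 0 := map_zero _
  rw [h3] at h2
  exact lineCoord_self_eq_zero_iff.1
    ((mul_eq_zero.1 h2.symm).resolve_left fun h => h1 (lineCoord_self_eq_zero_iff.1 h))

omit [CompactSpace X] [MeasurableSpace X] [BorelSpace X] [SecondCountableTopology X] in
theorem coe_eq_sum_equivFun_smul {k : ℕ} (b : Module.Basis (Fin (h0 L E k)) ℂ (H0 L E k))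
    (s : H0 L E k) (x : X) : s.1 x = ∑ i, b.equivFun s i • (b i).1 x := by
  let ev : H0 L E k →ₗ[ℂ] ⨂[ℂ]^k (L x) := LinearMap.proj x ∘ₗ (H0 L E k).subtype
  calc s.1 x = ev (∑ i, b.equivFun s i • b i) := by rw [b.sum_equivFun]; rfl
    _ = ∑ i, b.equivFun s i • (b i).1 x := by
      rw [map_sum]
      simp only [map_smul]
      rfl

open scoped ComplexOrder in
/-- The bound for the Christoffel-Darboux kernel in terms of the coordinates of a space `V` of
sections that the multiplier `s₁ / s₂` maps into holomorphic sections. -/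
theorem integral_bergmanKernel_le (h : HermitianMetric L) (μ : Measure X) [IsFiniteMeasure μ]
    {k₀ k : ℕ} (s₁ s₂ : H0 L E k₀) (hdisj : Disjoint μ.support (zeroLocus s₂)) {M : ℝ}
    (hM : ∀ᵐ x ∂μ, ‖sectionRatio s₁ s₂ x‖ ≤ M)
    (b : Module.Basis (Fin (h0 L E k)) ℂ (H0 L E k)) (hb : IsHilbOrthonormal h μ b)
    (V : Submodule ℂ (H0 L E k))
    (hV : ∀ s ∈ V, ∃ t : H0 L E k, ∀ x ∉ zeroLocus s₂, sectionRatio s₁ s₂ x • s.1 x = t.1 x) :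
    Integrable (fun p : X × X => h.homNorm k p.1 p.2 (bergmanKernel h b p.1 p.2) ^ 2 *
      ‖sectionRatio s₁ s₂ p.1 - sectionRatio s₁ s₂ p.2‖ ^ 2) (μ.prod μ) ∧
    ∫ p : X × X, h.homNorm k p.1 p.2 (bergmanKernel h b p.1 p.2) ^ 2 *
      ‖sectionRatio s₁ s₂ p.1 - sectionRatio s₁ s₂ p.2‖ ^ 2 ∂(μ.prod μ) ≤
        2 * M ^ 2 * ((h0 L E k : ℝ) - Module.finrank ℂ V) := by
  have hW : ∀ x ∈ V.map (b.equivFun : H0 L E k →ₗ[ℂ] Fin (h0 L E k) → ℂ),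
      ∃ y : Fin (h0 L E k) → ℂ, ∀ᵐ p ∂μ, ∑ i, ∑ j,
        conj (sectionRatio s₁ s₂ p * x i - y i) * (sectionRatio s₁ s₂ p * x j - y j) *
          h.powForm k p ((b i).1 p) ((b j).1 p) = 0 := by
    rintro _ ⟨s, hs, rfl⟩
    obtain ⟨t, ht⟩ := hV s hs
    refine ⟨b.equivFun t, ?_⟩
    filter_upwards [Measure.support_mem_ae (μ := μ)] with p hp
    have h1 : ∑ i, (sectionRatio s₁ s₂ p * b.equivFun s i - b.equivFun t i) • (b i).1 p = 0 := by
      simp only [sub_smul, mul_smul, Finset.sum_sub_distrib, ← Finset.smul_sum]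
      rw [← coe_eq_sum_equivFun_smul, ← coe_eq_sum_equivFun_smul,
        ht p (Set.disjoint_left.1 hdisj hp), sub_self]
    exact (h.powForm_sum_smul k p _ fun i => (b i).1 p).symm.trans
      ((congrArg (fun v => h.powForm k p v v) h1).trans (LinearMap.map_zero _))
  obtain ⟨h1, h2⟩ := integral_gram_mul_norm_sub_sq_le
    (G := fun i j p => h.powForm k p ((b i).1 p) ((b j).1 p))
    (fun i j => h.integrable_powForm μ (b i) (b j)) (fun i j p => h.conj_powForm k p _ _)
    (fun p c => by
      rw [← h.powForm_sum_smul k p c fun i => (b i).1 p, ← h.ofReal_powForm_self_re]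
      exact_mod_cast h.powForm_self_re_nonneg k p _)
    (fun i j => hb i j) (aestronglyMeasurable_sectionRatio s₁ s₂ hdisj) hM _ hW
  simp only [← h.homNorm_bergmanKernel_sq, ← Complex.ofReal_mul] at h1 h2
  rw [LinearEquiv.finrank_map_eq, Fintype.card_fin] at h2
  have h3 := integral_re h1
  simp only [RCLike.re_to_complex, Complex.ofReal_re] at h3
  rw [h3]
  have h4 := h1.re
  simp only [RCLike.re_to_complex, Complex.ofReal_re] at h4
  exact ⟨h4, h2⟩

end KernelBound

/-! ### The main estimate -/

theorem mainTheorem4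
    {E : Type*} [NormedAddCommGroup E] [NormedSpace ℂ E] [FiniteDimensional ℂ E]
    {X : Type*} [TopologicalSpace X] [T2Space X] [CompactSpace X]
    [ChartedSpace E X] [IsManifold 𝓘(ℂ, E) ω X]
    [MeasurableSpace X] [BorelSpace X]
    (L : X → Type*) [∀ x, AddCommGroup (L x)] [∀ x, Module ℂ (L x)]
    [TopologicalSpace (TotalSpace ℂ L)] [∀ x, TopologicalSpace (L x)]
    [FiberBundle ℂ L] [VectorBundle ℂ ℂ L] [ContMDiffVectorBundle ω ℂ L 𝓘(ℂ, E)]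
    (_hL : IsBig L E) (h : HermitianMetric L)
    (k₀ : ℕ) (s₁ s₂ : H0 L E k₀) (hs : LinearIndependent ℂ ![s₁, s₂])
    (μ₀ : Measure X) [IsFiniteMeasure μ₀]
    (hdisj : Disjoint μ₀.support (zeroLocus s₂))
    (hsupp : ∀ A : Set X, IsAnalyticSubset E A → μ₀.support ⊆ A → A = Set.univ) :
    ∃ C : ℝ, 0 < C ∧ ∀ k : ℕ, 1 ≤ k →
      (∃ b : Module.Basis (Fin (h0 L E k)) ℂ (H0 L E k), IsHilbOrthonormal h μ₀ b) ∧
      ∀ b : Module.Basis (Fin (h0 L E k)) ℂ (H0 L E k), IsHilbOrthonormal h μ₀ b →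
        Integrable (fun p : X × X => h.homNorm k p.1 p.2 (bergmanKernel h b p.1 p.2) ^ 2 *
          ‖sectionRatio s₁ s₂ p.1 - sectionRatio s₁ s₂ p.2‖ ^ 2) (μ₀.prod μ₀) ∧
        ∫ p : X × X, h.homNorm k p.1 p.2 (bergmanKernel h b p.1 p.2) ^ 2 *
            ‖sectionRatio s₁ s₂ p.1 - sectionRatio s₁ s₂ p.2‖ ^ 2 ∂(μ₀.prod μ₀)
          ≤ C * ((h0 L E k : ℝ) - if k₀ ≤ k then (h0 L E (k - k₀) : ℝ) else 0) := by
  have : ProperSpace E := FiniteDimensional.proper ℂ E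
  -- Used to make the support conull, so that bounds on it hold almost everywhere.
  have : SecondCountableTopology X := ChartedSpace.secondCountable_of_sigmaCompact E X
  obtain ⟨M, hM⟩ := exists_ae_norm_sectionRatio_le μ₀ s₁ s₂ hdisj
  -- The summand `1` only keeps the constant positive when `M = 0`.
  refine ⟨2 * M ^ 2 + 1, by positivity, fun k _ =>
    ⟨exists_isHilbOrthonormal h μ₀ hsupp k, fun b hb => ?_⟩⟩
  have := finiteDimensional_H0 (E := E) h k
  obtain ⟨V, hVdim, hV⟩ : ∃ V : Submodule ℂ (H0 L E k),
      (Module.finrank ℂ V : ℝ) = (if k₀ ≤ k then (h0 L E (k - k₀) : ℝ) else 0) ∧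
      ∀ s ∈ V, ∃ t : H0 L E k, ∀ x ∉ zeroLocus s₂, sectionRatio s₁ s₂ x • s.1 x = t.1 x := by
    by_cases hk : k₀ ≤ k
    · have hadd : k₀ + (k - k₀) = k := Nat.add_sub_cancel' hk
      refine ⟨LinearMap.range (mulSection s₂ (k - k₀) k hadd), ?_, ?_⟩
      · rw [if_pos hk, LinearMap.finrank_range_of_inj (mulSection_injective hadd s₂ hdisj hsupp)]
        rfl
      · rintro _ ⟨r, rfl⟩
        exact ⟨mulSection s₁ (k - k₀) k hadd r,
          fun x hx => sectionRatio_smul_mulSection s₁ s₂ hadd r hx⟩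
    -- For `k < k₀` no multiples of `s₂` are available; the trivial bound by `n_k` matches the
    -- convention `n_{k-k₀} = 0`.
    · refine ⟨⊥, by simp [hk], fun s hs => ⟨0, fun x _ => ?_⟩⟩
      rw [(Submodule.mem_bot ℂ).1 hs]
      exact smul_zero _
  obtain ⟨h1, h2⟩ := integral_bergmanKernel_le h μ₀ s₁ s₂ hdisj hM b hb V hV
  refine ⟨h1, h2.trans ?_⟩
  rw [hVdim] at h2 ⊢
  refine mul_le_mul_of_nonneg_right (by linarith) ?_
  rw [← hVdim, sub_nonneg]
  exact_mod_cast Submodule.finrank_le V
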